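/- Let $n\ge 0$ and let $\vec\kappa=\langle\kappa_0,\dots,\kappa_n\rangle$ be a tuple of cardinals. Write $\alpha(\kappa_i)=\kappa_i\sqcup\{\infty\}$ for the one-point compactification of the discrete space of size $\kappa_i$, put $X(\vec\kappa)=\prod_{i\le n}\alpha(\kappa_i)$, and let $X(\vec\kappa)^-$ be the subspace obtained by deleting the point $(\infty,\dots,\infty)$. For $A\subseteq\{0,\dots,n\}$ let $$\mathcal D_A=\{\vec x\in X(\vec\kappa): x_i\ne\infty\text{ for all }i\in A\},\qquad F_A=\{\vec x\in X(\vec\kappa): x_i\neq\infty\iff i\in A\},$$ and for $\vec x\in F_A$ and finite sets $\mathcal E_j\subseteq\kappa_j$ $(j\notin A)$ let $$\mathcal N_A(\vec x,\vec{\mathcal E})=\{\vec y\in X(\vec\kappa): y_i=x_i\text{ for all }i\in A,\text{ and } y_j=\infty\text{ or }y_j\notin\mathcal E_j\text{ for all }j\notin A\}.$$ For an integer $-1\le k\le n$, a $k$-Fubini partition of $X(\vec\kappa)^-$ is a family $\langle Y_i: i\le n\rangle$ of pairwise disjoint (possibly empty) sets with union $X(\vec\kappa)^-$ such that for every $A\subseteq\{0,\dots,n\}$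 with $|A|\ge k+1$: 1. for every $i\notin A$ the set $Y_i\cap\mathcal D_A$ is clopen in $\mathcal D_A$; and 2. for every $\vec x\in F_A$ there are finite sets $\mathcal E_j\subseteq\kappa_j$ $(j\notin A)$ with $\mathcal N_A(\vec x,\vec{\mathcal E})\subseteq\bigcup_{i\in A}Y_i$. Theorem. Let $-1\le k\le n$ and suppose that $X(\vec\kappa)^-$ admits a $k$-Fubini partition. Then, for sheaf cohomology with coefficients in the constant sheaf $\underline{\mathbb Z_2}$ with value $\mathbb Z_2=\mathbb Z/2\mathbb Z$: (i) $H^{\ell}(X(\vec\kappa)^-,\underline{\mathbb Z_2})=0$ for all $\ell\ge k+1$; in particular $H^{k+1}(X(\vec\kappa)^-,\underline{\mathbb Z_2})=0$. (ii) If $k\ge0$, then for every tuple of cardinals $\vec\lambda=\langle\lambda_0,\dots,\lambda_n\rangle$ with $\lambda_i\le\kappa_i$ for all $i\le n$ there is an injective group homomorphism $$H^k(X(\vec\lambda)^-,\underline{\mathbb Z_2})\hookrightarrow H^k(X(\vec\kappa)^-,\underline{\mathbb Z_2}).$$ -/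

import Mathlib

open CategoryTheory

universe u

namespace Cuboid

/-- The discrete space whose set of points is the chosen representative of the cardinal `c`. -/
def Disc (c : Cardinal.{u}) : Type u := c.out

instance (c : Cardinal.{u}) : TopologicalSpace (Disc c) := ⊥

instance (c : Cardinal.{u}) : DiscreteTopology (Disc c) := ⟨rfl⟩

variable {n : ℕ}

/-- `X(κ) = ∏ i, α(κ i)`, where `α` is the one-point compactification of a discrete space. -/
abbrev Space (κ : Fin (n + 1) → Cardinal.{u}) : Type u :=
  ∀ i, OnePoint (Disc (κ i))

/-- The point `(∞, …, ∞)` of `X(κ)`. -/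
def inftyPt (κ : Fin (n + 1) → Cardinal.{u}) : Space κ :=
  fun _ => OnePoint.infty

/-- `X(κ)⁻`, that is `X(κ)` with the point `(∞, …, ∞)` deleted, as a topological space. -/
def Punctured (κ : Fin (n + 1) → Cardinal.{u}) : TopCat.{u} :=
  TopCat.of {x : Space κ // x ≠ inftyPt κ}

/-- `D_A`: the points all of whose coordinates with index in `A` are different from `∞`. -/
def D (κ : Fin (n + 1) → Cardinal.{u}) (A : Finset (Fin (n + 1))) : Set (Space κ) :=
  {x | ∀ i ∈ A, x i ≠ OnePoint.infty}

/-- The facet `F_A`: the coordinates different from `∞` are exactly those with index in `A`. -/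
def Facet (κ : Fin (n + 1) → Cardinal.{u}) (A : Finset (Fin (n + 1))) : Set (Space κ) :=
  {x | ∀ i, x i ≠ OnePoint.infty ↔ i ∈ A}

/-- The basic open set `N_A(x, E)`; only the finite sets `E j` with `j ∉ A` matter. -/
def Nbhd (κ : Fin (n + 1) → Cardinal.{u}) (A : Finset (Fin (n + 1))) (x : Space κ)
    (E : ∀ j, Finset (Disc (κ j))) : Set (Space κ) :=
  {y | (∀ i ∈ A, y i = x i) ∧
    ∀ j, j ∉ A → y j = OnePoint.infty ∨ ∃ z : Disc (κ j), z ∉ E j ∧ y j = (z : OnePoint _)}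

/-- `Y` is a `k`-Fubini partition of `X(κ)⁻` (pieces are allowed to be empty). -/
structure IsFubini (κ : Fin (n + 1) → Cardinal.{u}) (k : ℤ)
    (Y : Fin (n + 1) → Set (Space κ)) : Prop where
  disjoint : Pairwise fun i j => Disjoint (Y i) (Y j)
  cover : ⋃ i, Y i = {x | x ≠ inftyPt κ}
  clopen : ∀ A : Finset (Fin (n + 1)), k + 1 ≤ (A.card : ℤ) → ∀ i, i ∉ A →
    IsClopen {x : D κ A | (x : Space κ) ∈ Y i}
  nbhd : ∀ A : Finset (Fin (n + 1)), k + 1 ≤ (A.card : ℤ) → ∀ x ∈ Facet κ A,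
    ∃ E : ∀ j, Finset (Disc (κ j)), Nbhd κ A x E ⊆ ⋃ i ∈ A, Y i

/-- The constant sheaf of abelian groups with value `ℤ/2` on a topological space. -/
noncomputable def constZ2 (X : TopCat.{u}) :
    Sheaf (Opens.grothendieckTopology X) AddCommGrpCat.{u} :=
  (constantSheaf (Opens.grothendieckTopology X) AddCommGrpCat.{u}).obj
    (AddCommGrpCat.of (ULift.{u} (ZMod 2)))

/-- The sheaf cohomology group `H^m(X(κ)⁻, ℤ/2)`. -/
noncomputable abbrev H (m : ℕ) (κ : Fin (n + 1) → Cardinal.{u}) : Type u :=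
  Sheaf.H.{u} (constZ2 (Punctured κ)) m

end Cuboid

/-!
Let `Dᵢ` be the open set of points of `X(κ)⁻` whose `i`-th coordinate is finite. The sets `Dᵢ` cover
`X(κ)⁻`, and each of their nonempty finite intersections is a disjoint union of open profinite
spaces, so that pushforwards of locally constant functions from it are acyclic. Hence the Čech
complex of the cover computes the cohomology of `X(κ)⁻` with constant coefficients.

Modulo 2 there are no signs, and a Fubini partition gives a contraction of this complex: a point
`x ∈ Yᵢ` contributes the value at `A ∪ {i}` to the cone at `A`, or zero if `i ∈ A`. The two Fubini
conditions say that for `|A| ≥ k + 1` this is defined and locally constant on `⋂ i ∈ A, Dᵢ`. It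
follows that cohomology vanishes above degree `k`.

A locally constant function extends from a closed subspace of each such intersection. A cocycle
of degree `k` on `X(μ)⁻` therefore extends to a cochain `e` on `X(κ)⁻`, and `e` minus the cone of
`de` is a cocycle with the same restriction. So restriction is surjective on `Hᵏ`; as a map of
`ℤ/2`-vector spaces it splits.
-/

open Opposite TopologicalSpace Topology Filter Limits

/-! ### Ultraparacompact spaces -/

theorem eventually_locallyConstant_subtype_eq {T M : Type*} [TopologicalSpace T] {p : T → Prop}
    (f : LocallyConstant {x // p x} M) (x : {x // p x}) :
    ∀ᶠ y in 𝓝 x.1, ∀ hy : p y, f ⟨y, hy⟩ = f x := by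
  have h := f.isLocallyConstant.eventually_eq x
  rw [nhds_subtype_eq_comap, eventually_comap] at h
  exact h.mono fun y hy hpy => hy ⟨y, hpy⟩ rfl

theorem isTopologicalBasis_isClopen_of_isInducing {S T : Type*} [TopologicalSpace S]
    [TopologicalSpace T] (hT : IsTopologicalBasis {s : Set T | IsClopen s}) {j : S → T}
    (hj : IsInducing j) : IsTopologicalBasis {s : Set S | IsClopen s} :=
  (hT.isInducing hj).of_isOpen_of_subset (fun _ h => h.isOpen)
    (Set.image_subset_iff.2 fun _ h => h.preimage hj.continuous)

/-- A space is ultraparacompact if every open cover has a refinement by pairwise disjoint open sets.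
The cover is encoded as a neighbourhood assignment `W` and the refinement as the fibres of a locally
constant choice of centres `c`. -/
def UltraparacompactSpace (T : Type*) [TopologicalSpace T] : Prop :=
  ∀ W : T → Set T, (∀ x, W x ∈ 𝓝 x) → ∃ c : LocallyConstant T T, ∀ y, y ∈ W (c y)

namespace UltraparacompactSpace

variable {T : Type*} [TopologicalSpace T]

theorem of_profinite [CompactSpace T] [T2Space T] [TotallyDisconnectedSpace T] :
    UltraparacompactSpace T := by
  intro W hW
  have hcover : IsOpenCover fun x : T => (⟨interior (W x), isOpen_interior⟩ : Opens T) :=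
    .of_sets _ (Set.eq_univ_of_forall fun x =>
      Set.mem_iUnion.2 ⟨x, mem_interior_iff_mem_nhds.2 (hW x)⟩)
  obtain ⟨N, V, hV, hVcover, hVdisj⟩ := hcover.exists_finite_nonempty_disjoint_clopen_cover
  choose center hcenter using fun j => (hV j).2
  choose part hpart using fun y => Set.mem_iUnion.1 (hVcover (Set.mem_univ y))
  have part_eq {y : T} {j : Fin N} (hy : y ∈ V j) : part y = j :=
    hVdisj.eq fun h => Set.disjoint_left.1 (Clopens.coe_disjoint.2 h) (hpart y) hy
  refine ⟨⟨center ∘ part, .comp ((IsLocallyConstant.iff_eventually_eq _).2 fun y => ?_) center⟩,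
    fun y => interior_subset (hcenter (part y) (hpart y))⟩
  filter_upwards [(V (part y)).isClopen.isOpen.mem_nhds (hpart y)] with z hz using part_eq hz

theorem of_fibers {J : Type*} (q : LocallyConstant T J)
    (hq : ∀ j, UltraparacompactSpace (q ⁻¹' {j})) : UltraparacompactSpace T := by
  intro W hW
  choose c hc using fun j => hq j (fun x => Subtype.val ⁻¹' W x) fun x =>
    continuous_subtype_val.continuousAt (hW x)
  have center_eq {y : T} {j : J} (hy : q y = j) : (c (q y) ⟨y, rfl⟩ : T) = c j ⟨y, hy⟩ := by
    subst hy; rfl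
  refine ⟨⟨fun y => c (q y) ⟨y, rfl⟩, (IsLocallyConstant.iff_eventually_eq _).2 fun y => ?_⟩,
    fun y => hc (q y) ⟨y, rfl⟩⟩
  filter_upwards [q.isLocallyConstant.eventually_eq y,
    eventually_locallyConstant_subtype_eq (c (q y)) ⟨y, rfl⟩] with z (hz : q z = q y) hcz
  rw [center_eq hz, hcz hz]

theorem sigma {ι : Type*} {E : ι → Type*} [∀ i, TopologicalSpace (E i)]
    (hE : ∀ i, UltraparacompactSpace (E i)) : UltraparacompactSpace (Σ i, E i) := by
  intro W hW
  choose c hc using fun i => hE i (fun x => Sigma.mk i ⁻¹' W ⟨i, x⟩) fun x =>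
    continuous_sigmaMk.continuousAt (hW ⟨i, x⟩)
  refine ⟨⟨fun e => ⟨e.1, c e.1 e.2⟩, (IsLocallyConstant.iff_eventually_eq _).2 ?_⟩,
    fun e => hc e.1 e.2⟩
  rintro ⟨i, x⟩
  rw [Sigma.nhds_mk, eventually_map]
  exact ((c i).isLocallyConstant.eventually_eq x).mono fun y hy => congrArg (Sigma.mk i) hy

variable {Z : Type*} [TopologicalSpace Z] {j : Z → T}

theorem exists_locallyConstant_option (hT : UltraparacompactSpace T) (hj : IsClosedEmbedding j)
    (W : Z → Set Z) (hW : ∀ z, W z ∈ 𝓝 z) :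
    ∃ r : LocallyConstant T (Option Z), ∀ z, ∃ z', r (j z) = some z' ∧ z ∈ W z' := by
  have hnhds (x : T) : ∃ V ∈ 𝓝 x, ∀ z, j z ∈ V → ∃ z', j z' = x ∧ z ∈ W z' := by
    by_cases hx : x ∈ Set.range j
    · obtain ⟨z', rfl⟩ := hx
      obtain ⟨V, hV, hVW⟩ := hj.isInducing.nhds_eq_comap z' ▸ hW z'
      exact ⟨V, hV, fun z hz => ⟨z', rfl, hVW hz⟩⟩
    · exact ⟨_, hj.isClosed_range.isOpen_compl.mem_nhds hx, fun z hz => (hz ⟨z, rfl⟩).elim⟩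
  choose V hV hVW using hnhds
  obtain ⟨c, hc⟩ := hT V hV
  refine ⟨c.map (Function.partialInv j), fun z => ?_⟩
  obtain ⟨z', hz', hzW⟩ := hVW (c (j z)) z (hc (j z))
  exact ⟨z', by simp [← hz', Function.partialInv_left hj.injective], hzW⟩

theorem of_isClosedEmbedding (hT : UltraparacompactSpace T) (hj : IsClosedEmbedding j) :
    UltraparacompactSpace Z := by
  intro W hW
  obtain ⟨r, hr⟩ := hT.exists_locallyConstant_option hj W hW
  choose c hrc hc using hr
  refine ⟨⟨c, (IsLocallyConstant.iff_eventually_eq _).2 fun z => ?_⟩, hc⟩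
  filter_upwards [hj.continuous.continuousAt.eventually (r.isLocallyConstant.eventually_eq (j z))]
    with y (hy : r (j y) = r (j z))
  exact Option.some_injective _ (by rw [← hrc, ← hrc, hy])

theorem exists_extension {M : Type*} [Nonempty M] (hT : UltraparacompactSpace T)
    (hj : IsClosedEmbedding j) (f : LocallyConstant Z M) :
    ∃ F : LocallyConstant T M, ∀ z, F (j z) = f z := by
  obtain ⟨r, hr⟩ := hT.exists_locallyConstant_option hj (fun z => {y | f y = f z})
    f.isLocallyConstant.eventually_eq
  refine ⟨r.map fun o => o.elim (Classical.arbitrary M) f, fun z => ?_⟩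
  obtain ⟨z', hz', hz : f z = f z'⟩ := hr z
  simp [hz', hz]

end UltraparacompactSpace

/-! ### The sheaf of locally constant functions -/

/-- Sheaves of abelian groups on a topological space. -/
abbrev AbSheaf (X : TopCat.{u}) : Type (u + 1) :=
  Sheaf (Opens.grothendieckTopology X) AddCommGrpCat.{u}

section LocConst

variable (X : TopCat.{u}) (M : Type u) [AddCommGroup M]

/-- The presheaf of locally constant functions with values in `M`. -/
def locConstPresheaf : TopCat.Presheaf AddCommGrpCat.{u} X where
  obj U := AddCommGrpCat.of (LocallyConstant U.unop M)
  map i := AddCommGrpCat.ofHom <| LocallyConstant.comapAddMonoidHom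
    ⟨Set.inclusion i.unop.le, continuous_inclusion i.unop.le⟩
  map_id _ := rfl
  map_comp _ _ := rfl

theorem locConstPresheaf_isSheaf : (locConstPresheaf X M).IsSheaf := by
  refine (TopCat.Presheaf.isSheaf_iff_isSheafUniqueGluing _).2 fun ι U sf hsf => ?_
  change ∀ i, LocallyConstant (U i) M at sf
  have agree {i j : ι} {x : X} (hi : x ∈ U i) (hj : x ∈ U j) : sf i ⟨x, hi⟩ = sf j ⟨x, hj⟩ :=
    LocallyConstant.congr_fun (X := (U i ⊓ U j : Opens X)) (hsf i j) ⟨x, hi, hj⟩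
  choose c hc using fun x : (iSup U : Opens X) => Opens.mem_iSup.1 x.2
  have glue_isLocallyConstant : IsLocallyConstant fun x => sf (c x) ⟨x, hc x⟩ := by
    refine (IsLocallyConstant.iff_eventually_eq _).2 fun x => ?_
    filter_upwards [continuous_subtype_val.continuousAt.eventually
      (eventually_locallyConstant_subtype_eq (sf (c x)) ⟨x, hc x⟩),
      continuous_subtype_val.continuousAt.eventually ((U (c x)).isOpen.mem_nhds (hc x))]
      with y hy hyU
    exact (agree _ hyU).trans (hy hyU)
  refine ⟨⟨_, glue_isLocallyConstant⟩, fun i => ?_, fun f hf => ?_⟩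
  · exact LocallyConstant.ext (X := U i) fun x => agree _ _
  · exact LocallyConstant.ext (X := (iSup U : Opens X)) fun x =>
      LocallyConstant.congr_fun (X := U (c x)) (hf (c x)) ⟨x, hc x⟩

/-- The sheaf of locally constant functions with values in `M`. -/
def locConstSheaf : AbSheaf X :=
  ⟨locConstPresheaf X M, locConstPresheaf_isSheaf X M⟩

/-- The comparison from the constant presheaf to the sheaf of locally constant functions. -/
def constToLocConst :
    (Functor.const (Opens X)ᵒᵖ).obj (AddCommGrpCat.of M) ⟶ (locConstSheaf X M).obj where
  app _ := AddCommGrpCat.ofHom LocallyConstant.constAddMonoidHom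
  naturality _ _ _ := rfl

instance : Presheaf.IsLocallyInjective (Opens.grothendieckTopology X) (constToLocConst X M) where
  equalizerSieve_mem {U} a b h x hx := by
    obtain rfl : a = b := LocallyConstant.congr_fun (X := U.unop) h ⟨x, hx⟩
    exact ⟨U.unop, 𝟙 _, rfl, hx⟩

instance : Presheaf.IsLocallySurjective (Opens.grothendieckTopology X) (constToLocConst X M) where
  imageSieve_mem {U} f x hx := by
    change LocallyConstant U M at f
    obtain ⟨V, hV, hVo, hxV⟩ :=
      eventually_nhds_iff.1 (eventually_locallyConstant_subtype_eq f ⟨x, hx⟩)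
    refine ⟨⟨V ∩ U, hVo.inter U.isOpen⟩, homOfLE fun y hy => hy.2, ⟨f ⟨x, hx⟩, ?_⟩, hxV, hx⟩
    exact LocallyConstant.ext (X := (⟨V ∩ U, hVo.inter U.isOpen⟩ : Opens X)) fun y =>
      (hV y y.2.1 y.2.2).symm

theorem nonempty_constantSheaf_iso_locConstSheaf :
    Nonempty ((constantSheaf (Opens.grothendieckTopology X) AddCommGrpCat.{u}).obj
      (AddCommGrpCat.of M) ≅ locConstSheaf X M) := by
  let lift := sheafifyLift (Opens.grothendieckTopology X) (constToLocConst X M)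
    (locConstSheaf X M).property
  have fac : toSheafify _ _ ≫ lift = constToLocConst X M := toSheafify_sheafifyLift _ _ _
  have hinj : Presheaf.IsLocallyInjective (Opens.grothendieckTopology X) lift :=
    Presheaf.isLocallyInjective_of_isLocallyInjective_of_isLocallySurjective_fac _ _ fac
  have hsurj : Presheaf.IsLocallySurjective (Opens.grothendieckTopology X) lift :=
    Presheaf.isLocallySurjective_of_isLocallySurjective_fac _ fac
  let liftHom : (constantSheaf (Opens.grothendieckTopology X) AddCommGrpCat.{u}).obj
    (AddCommGrpCat.of M) ⟶ locConstSheaf X M := ⟨lift⟩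
  have : IsIso liftHom := (Sheaf.isLocallyBijective_iff_isIso liftHom).1 ⟨hinj, hsurj⟩
  exact ⟨asIso liftHom⟩

end LocConst

/-! ### Acyclicity of direct images from ultraparacompact spaces -/

namespace AbSheaf

variable {X : TopCat.{u}}

theorem subsingleton_sections (F : AbSheaf X) {U : Opens X} (hU : ∀ x, x ∉ U) :
    Subsingleton (F.obj.obj (op U)) :=
  ⟨fun s t => TopCat.Sheaf.eq_of_locally_eq' (F := F) (fun i : PEmpty.{u + 1} => i.elim) U
    (fun i => i.elim) (fun x hx => (hU x hx).elim) s t fun i => i.elim⟩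

theorem epi_iff_locallySurjective {F G : AbSheaf X} (g : F ⟶ G) :
    Epi g ↔ ∀ (U : Opens X) (s : G.obj.obj (op U)), ∀ x ∈ U, ∃ (V : Opens X) (h : V ≤ U),
      x ∈ V ∧ ∃ t, g.hom.app (op V) t = G.obj.map (homOfLE h).op s := by
  refine (TopCat.Sheaf.isLocallySurjective_iff_epi (X := X) g).symm.trans <|
    (TopCat.Presheaf.isLocallySurjective_iff (X := X) g.hom).trans ?_
  refine forall₂_congr fun U s => forall₂_congr fun x _ => exists_congr fun V => ?_
  exact ⟨fun ⟨h, ht, hx⟩ => ⟨h, hx, ht⟩, fun ⟨h, hx, ht⟩ => ⟨h, ht, hx⟩⟩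

theorem surjective_app_of_epi {F G : AbSheaf X} (g : F ⟶ G) [Epi g] {U : Opens X}
    (hU : UltraparacompactSpace U) : Function.Surjective (g.hom.app (op U)) := by
  intro s
  choose V hVU hxV t ht using fun x : U => (epi_iff_locallySurjective g).1 ‹_› U s x x.2
  obtain ⟨c, hc⟩ := hU (fun x => Subtype.val ⁻¹' (V x : Set X)) fun x =>
    continuous_subtype_val.continuousAt ((V x).isOpen.mem_nhds (hxV x))
  let O (x : U) : Opens X := ⟨Subtype.val '' (c ⁻¹' {x}),
    U.isOpen.isOpenMap_subtype_val _ (c.isLocallyConstant {x})⟩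
  have hOV (x : U) : O x ≤ V x := by rintro _ ⟨y, rfl, rfl⟩; exact hc y
  have hOU (x : U) : O x ≤ U := (hOV x).trans (hVU x)
  have hcover : U ≤ iSup O := fun y hy => Opens.mem_iSup.2 ⟨c ⟨y, hy⟩, ⟨y, hy⟩, rfl, rfl⟩
  have hdisj {x y : U} (hxy : x ≠ y) (z : X) : z ∉ O x ⊓ O y := by
    rintro ⟨⟨a, rfl, rfl⟩, b, rfl, hb⟩
    exact hxy (congrArg c (Subtype.ext hb.symm))
  obtain ⟨r, hr, -⟩ := TopCat.Sheaf.existsUnique_gluing' (F := F) O U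
    (fun x => homOfLE (hOU x)) hcover (fun x => F.obj.map (homOfLE (hOV x)).op (t x))
    fun x y => by
      obtain rfl | hxy := eq_or_ne x y
      · rfl
      · exact (F.subsingleton_sections (hdisj hxy)).elim _ _
  refine ⟨r, TopCat.Sheaf.eq_of_locally_eq' (F := G) O U
    (fun x => homOfLE (hOU x)) hcover _ _ fun x => ?_⟩
  calc G.obj.map (homOfLE (hOU x)).op (g.hom.app (op U) r)
      = g.hom.app (op (O x)) (F.obj.map (homOfLE (hOU x)).op r) :=
        (NatTrans.naturality_apply g.hom _ r).symm
    _ = g.hom.app (op (O x)) (F.obj.map (homOfLE (hOV x)).op (t x)) := congrArg _ (hr x)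
    _ = G.obj.map (homOfLE (hOV x)).op (g.hom.app (op (V x)) (t x)) :=
        NatTrans.naturality_apply g.hom _ (t x)
    _ = G.obj.map (homOfLE (hOV x)).op (G.obj.map (homOfLE (hVU x)).op s) := by rw [ht]
    _ = G.obj.map (homOfLE (hOU x)).op s := by
        rw [← ConcreteCategory.comp_apply, ← G.obj.map_comp]; rfl

section Connecting

open Abelian

variable {S : ShortComplex (AbSheaf X)}

/-- The connecting homomorphism of the long exact cohomology sequence. -/
noncomputable def connecting (hS : S.ShortExact) (q : ℕ) : Sheaf.H S.X₃ q →+ Sheaf.H S.X₁ (q + 1) :=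
  hS.extClass.postcomp _ rfl

theorem connecting_eq_zero_iff (hS : S.ShortExact) (q : ℕ) (x : Sheaf.H S.X₃ q) :
    connecting hS q x = 0 ↔ ∃ y, Sheaf.H.map S.g q y = x := by
  refine ⟨Ext.covariant_sequence_exact₃ _ hS x rfl, ?_⟩
  rintro ⟨y, rfl⟩
  change Ext.comp (Ext.comp y _ (add_zero q)) hS.extClass rfl = 0
  rw [Ext.comp_assoc_of_second_deg_zero, hS.comp_extClass, Ext.comp_zero]

theorem connecting_surjective (hS : S.ShortExact) (q : ℕ)
    [Subsingleton (Sheaf.H S.X₂ (q + 1))] : Function.Surjective (connecting hS q) := fun x =>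
  Ext.covariant_sequence_exact₁ _ hS x (Subsingleton.elim (α := Sheaf.H S.X₂ (q + 1)) _ _) rfl

theorem connecting_bijective (hS : S.ShortExact) (q : ℕ) [Subsingleton (Sheaf.H S.X₂ q)]
    [Subsingleton (Sheaf.H S.X₂ (q + 1))] : Function.Bijective (connecting hS q) := by
  refine ⟨(injective_iff_map_eq_zero _).2 fun x hx => ?_, connecting_surjective hS q⟩
  obtain ⟨y, rfl⟩ := (connecting_eq_zero_iff hS q x).1 hx
  rw [Subsingleton.elim y 0, map_zero]

theorem subsingleton_H_of_surjective_map (hS : S.ShortExact) (q : ℕ)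
    [Subsingleton (Sheaf.H S.X₂ (q + 1))]
    (hg : Function.Surjective (Sheaf.H.map S.g q)) : Subsingleton (Sheaf.H S.X₁ (q + 1)) := by
  refine subsingleton_of_forall_eq 0 fun x => ?_
  obtain ⟨y, rfl⟩ := connecting_surjective hS q x
  exact (connecting_eq_zero_iff hS q y).2 (hg y)

end Connecting

theorem surjective_H_map_zero {F G : AbSheaf X} {g : F ⟶ G}
    (hg : Function.Surjective (g.hom.app (op ⊤))) : Function.Surjective (Sheaf.H.map g 0) := by
  have hcomp : Sheaf.H.map g 0 ∘ (Sheaf.H.equiv₀ F isTerminalTop).symm =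
      (Sheaf.H.equiv₀ G isTerminalTop).symm ∘ g.hom.app (op ⊤) :=
    funext (Sheaf.H.equiv₀_symm_naturality isTerminalTop g)
  exact .of_comp (hcomp ▸ (AddEquiv.surjective _).comp hg)

section Pushforward

variable {E : TopCat.{u}} (p : E ⟶ X)

/-- Direct image of abelian sheaves along a continuous map. -/
noncomputable abbrev pushforward : AbSheaf E ⥤ AbSheaf X :=
  (Opens.map p).sheafPushforwardContinuous AddCommGrpCat.{u} _ _

instance : (pushforward p).Additive where

instance (I : AbSheaf E) [Injective I] : Injective ((pushforward p).obj I) := by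
  have : ReflectsLimits (forget AddCommGrpCat.{u}) := reflectsLimits_of_reflectsIsomorphisms
  have : PreservesFiniteLimits ((Opens.map p).sheafPullback AddCommGrpCat.{u}
      (Opens.grothendieckTopology X) (Opens.grothendieckTopology E)) :=
    Functor.sheafPullbackConstruction.preservesFiniteLimits _ _ _ _
  have : ((Opens.map p).sheafPullback AddCommGrpCat.{u}
      (Opens.grothendieckTopology X) (Opens.grothendieckTopology E)).PreservesMonomorphisms :=
    preservesMonomorphisms_of_preservesLimitsOfShape _
  exact Injective.injective_of_adjoint
    ((Opens.map p).sheafAdjunctionContinuous AddCommGrpCat.{u} _ _) I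

theorem epi_pushforward_map (hX : IsTopologicalBasis {s : Set X | IsClopen s})
    (hE : UltraparacompactSpace E) {F G : AbSheaf E} (g : F ⟶ G) [Epi g] :
    Epi ((pushforward p).map g) := by
  refine (epi_iff_locallySurjective _).2 fun U s x hx => ?_
  obtain ⟨V, hV, hxV, hVU⟩ := hX.exists_subset_of_mem_open hx U.isOpen
  have hpV : UltraparacompactSpace ((Opens.map p).obj ⟨V, hV.isOpen⟩) :=
    hE.of_isClosedEmbedding (hV.isClosed.preimage p.hom.continuous).isClosedEmbedding_subtypeVal
  exact ⟨⟨V, hV.isOpen⟩, hVU, hxV, surjective_app_of_epi g hpV _⟩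

theorem shortExact_pushforward (hX : IsTopologicalBasis {s : Set X | IsClopen s})
    (hE : UltraparacompactSpace E) {S : ShortComplex (AbSheaf E)} (hS : S.ShortExact) :
    (S.map (pushforward p)).ShortExact := by
  have := hS.mono_f
  have := hS.epi_g
  obtain ⟨hexact, hmono⟩ :=
    ((Functor.preservesFiniteLimits_tfae (pushforward p)).out 1 3 rfl rfl).mpr inferInstance
      S ⟨hS.exact, hS.mono_f⟩
  have hepi : Epi (S.map (pushforward p)).g := epi_pushforward_map p hX hE S.g
  exact { exact := hexact, mono_f := hmono, epi_g := hepi }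

theorem subsingleton_H_pushforward (hX : IsTopologicalBasis {s : Set X | IsClopen s})
    (hE : UltraparacompactSpace E) (G : AbSheaf E) (q : ℕ) :
    Subsingleton (Sheaf.H ((pushforward p).obj G) (q + 1)) := by
  have step (G : AbSheaf E) (q : ℕ) (h : Function.Surjective
      (Sheaf.H.map ((pushforward p).map (cokernel.π (Injective.ι G))) q)) :
      Subsingleton (Sheaf.H ((pushforward p).obj G) (q + 1)) := by
    let S : ShortComplex (AbSheaf E) :=
      .mk (Injective.ι G) (cokernel.π _) (cokernel.condition _)
    have : Injective (S.map (pushforward p)).X₂ :=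
      inferInstanceAs (Injective ((pushforward p).obj (Injective.under G)))
    exact subsingleton_H_of_surjective_map
      (shortExact_pushforward p hX hE (S := S) { exact := ShortComplex.exact_cokernel _ }) q h
  induction q generalizing G with
  | zero =>
    have htop : UltraparacompactSpace ((Opens.map p).obj ⊤) :=
      hE.of_isClosedEmbedding isClosed_univ.isClosedEmbedding_subtypeVal
    refine step G 0 (surjective_H_map_zero ?_)
    exact surjective_app_of_epi (cokernel.π (Injective.ι G)) htop
  | succ q ih =>
    have := ih (cokernel (Injective.ι G))
    exact step G (q + 1) fun y => ⟨0, this.elim _ _⟩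

theorem nonempty_locConstSheaf_iso_pushforward {p : E ⟶ X} (hp : IsHomeomorph p) (M : Type u)
    [AddCommGroup M] :
    Nonempty (locConstSheaf X M ≅ (pushforward p).obj (locConstSheaf E M)) := by
  let restricted (U : Opens X) : (Opens.map p).obj U ≃ₜ U :=
    (hp.homeomorph p).subtype fun _ => Iff.rfl
  exact ⟨(fullyFaithfulSheafToPresheaf _ _).preimageIso <| NatIso.ofComponents
    (fun U => (LocallyConstant.congrLeftₗ ℤ (restricted U.unop).symm).toAddEquiv.toAddCommGrpIso)
    fun _ => rfl⟩

end Pushforward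

/-! ### Cohomology from an acyclic resolution -/

section Kernel

variable {F G : AbSheaf X} (f : F ⟶ G)

/-- Sections of a kernel sheaf are the sections killed by the morphism. -/
noncomputable def kernelSections (U : Opens X) :
    (kernel f).obj.obj (op U) ≃+ (f.hom.app (op U)).hom.ker := by
  have hker (t : (kernel f).obj.obj (op U)) :
      f.hom.app (op U) ((kernel.ι f).hom.app (op U) t) = 0 := by
    change (kernel.ι f ≫ f).hom.app (op U) t = 0
    rw [kernel.condition]
    rfl
  have hmono : Mono ((kernel.ι f).hom.app (op U)) :=
    (NatTrans.mono_iff_mono_app _).1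
      (inferInstanceAs (Mono ((sheafToPresheaf _ _).map (kernel.ι f)))) _
  refine AddEquiv.ofBijective (((kernel.ι f).hom.app (op U)).hom.codRestrict _ hker)
    ⟨fun s t h => (AddCommGrpCat.mono_iff_injective _).1 hmono (congrArg Subtype.val h),
      fun s => ?_⟩
  obtain ⟨t, ht⟩ := TopCat.Sheaf.sections_exact_of_left_exact (X := X)
    (S := ShortComplex.mk (C := AbSheaf X) (kernel.ι f) f (kernel.condition f))
    (ShortComplex.exact_kernel f) (inferInstanceAs (Mono (kernel.ι f))) s.1 s.2
  exact ⟨t, Subtype.ext ht⟩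

theorem coe_kernelSections (U : Opens X) (t : (kernel f).obj.obj (op U)) :
    (kernelSections f U t : F.obj.obj (op U)) = (kernel.ι f).hom.app (op U) t := rfl

end Kernel

theorem exact_of_locally_exact {S : ShortComplex (AbSheaf X)}
    (h : ∀ (U : Opens X) (s : S.X₂.obj.obj (op U)), S.g.hom.app (op U) s = 0 → ∀ x ∈ U,
      ∃ (V : Opens X) (hV : V ≤ U), x ∈ V ∧
        ∃ t, S.f.hom.app (op V) t = S.X₂.obj.map (homOfLE hV).op s) : S.Exact := by
  refine S.exact_iff_epi_kernel_lift.2 ((epi_iff_locallySurjective _).2 fun U s x hx => ?_)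
  obtain ⟨V, hV, hxV, t, ht⟩ := h U _ (kernelSections S.g U s).2 x hx
  refine ⟨V, hV, hxV, t, (kernelSections S.g V).injective (Subtype.ext ?_)⟩
  calc (kernel.lift S.g S.f S.zero ≫ kernel.ι S.g).hom.app (op V) t
      = S.X₂.obj.map (homOfLE hV).op ((kernel.ι S.g).hom.app (op U) s) := by
        rw [kernel.lift_ι, ht]; rfl
    _ = _ := (NatTrans.naturality_apply (kernel.ι S.g).hom (homOfLE hV).op s).symm

section Resolution

variable {C : ℕ → AbSheaf X} {d : ∀ l, C l ⟶ C (l + 1)} (w : ∀ l, d l ≫ d (l + 1) = 0)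

/-- The sequence `0 → Zˡ → Cˡ → Zˡ⁺¹ → 0` of cocycle sheaves of a complex. -/
noncomputable abbrev cocycleSequence (l : ℕ) : ShortComplex (AbSheaf X) :=
  ShortComplex.mk (kernel.ι (d l)) (kernel.lift (d (l + 1)) (d l) (w l)) (by
    rw [← cancel_mono (kernel.ι _), Category.assoc, kernel.lift_ι, kernel.condition, zero_comp])

theorem shortExact_cocycleSequence {l : ℕ}
    (hex : (ShortComplex.mk (d l) (d (l + 1)) (w l)).Exact) :
    (cocycleSequence w l).ShortExact := by
  have hepi : Epi (cocycleSequence w l).g := hex.epi_kernelLift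
  have hmono : Mono (cocycleSequence w l).f := inferInstanceAs (Mono (kernel.ι (d l)))
  refine { exact := ShortComplex.exact_of_f_is_kernel _ (KernelFork.IsLimit.ofι' _ _ ?_) }
  refine fun {A} k hk => ⟨kernel.lift (d l) k ?_, kernel.lift_ι _ _ _⟩
  change k ≫ d l = 0
  rw [← kernel.lift_ι (d (l + 1)) (d l) (w l), reassoc_of% hk, zero_comp]

theorem nonempty_ker_quotient_range_equiv_H_one {l : ℕ}
    (hex : (ShortComplex.mk (d l) (d (l + 1)) (w l)).Exact) [Subsingleton (Sheaf.H (C l) 1)] :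
    Nonempty (((d (l + 1)).hom.app (op ⊤)).hom.ker ⧸
      ((d l).hom.app (op ⊤)).hom.range.addSubgroupOf ((d (l + 1)).hom.app (op ⊤)).hom.ker ≃+
        Sheaf.H (kernel (d l)) 1) := by
  have hS := shortExact_cocycleSequence w hex
  let sections : Sheaf.H (kernel (d (l + 1))) 0 ≃+ ((d (l + 1)).hom.app (op ⊤)).hom.ker :=
    (Sheaf.H.equiv₀ _ isTerminalTop).trans (kernelSections (d (l + 1)) ⊤)
  have sections_map (y : Sheaf.H (C l) 0) :
      (sections (Sheaf.H.map (cocycleSequence w l).g 0 y) : (C (l + 1)).obj.obj (op ⊤)) =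
        (d l).hom.app (op ⊤) (Sheaf.H.equiv₀ (C l) isTerminalTop y) := by
    rw [AddEquiv.trans_apply, ← Sheaf.H.equiv₀_naturality, coe_kernelSections]
    change (kernel.lift (d (l + 1)) (d l) (w l) ≫ kernel.ι (d (l + 1))).hom.app (op ⊤) _ = _
    rw [kernel.lift_ι]
  let π := (connecting hS 0).comp sections.symm.toAddMonoidHom
  have hπ : Function.Surjective π := (connecting_surjective hS 0).comp sections.symm.surjective
  have hker : ((d l).hom.app (op ⊤)).hom.range.addSubgroupOf _ = π.ker := by
    ext z
    refine (Equiv.exists_congr (Sheaf.H.equiv₀ (C l) isTerminalTop).toEquiv fun y => ?_).symm.trans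
      (connecting_eq_zero_iff hS 0 _).symm
    refine (sections.eq_symm_apply.trans Subtype.ext_iff).trans ?_
    rw [sections_map]
    rfl
  exact ⟨(QuotientAddGroup.quotientAddEquivOfEq hker).trans
    (QuotientAddGroup.quotientKerEquivOfSurjective π hπ)⟩

theorem nonempty_H_cocycles_equiv (hex : ∀ l, (ShortComplex.mk (d l) (d (l + 1)) (w l)).Exact)
    (hac : ∀ l q, Subsingleton (Sheaf.H (C l) (q + 1))) (l m : ℕ) :
    Nonempty (Sheaf.H (kernel (d (l + m))) 1 ≃+ Sheaf.H (kernel (d l)) (m + 1)) := by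
  induction m generalizing l with
  | zero => exact ⟨.refl _⟩
  | succ m ih =>
    obtain ⟨e⟩ := ih (l + 1)
    rw [Nat.add_right_comm, Nat.add_assoc] at e
    have := hac l m
    have := hac l (m + 1)
    exact ⟨e.trans (.ofBijective _
      (connecting_bijective (shortExact_cocycleSequence w (hex l)) (m + 1)))⟩

/-- The global coboundaries in degree `m` of an augmented complex `C 0 → C 1 → ⋯`, where `C 0` is
the sheaf being resolved, so that degree `m` sits at index `m + 1`. -/
def coboundaries (d : ∀ l, C l ⟶ C (l + 1)) : ∀ m, AddSubgroup ((C (m + 1)).obj.obj (op ⊤))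
  | 0 => ⊥
  | m + 1 => ((d (m + 1)).hom.app (op ⊤)).hom.range

/-- The degree `m` cohomology of the global sections of an augmented complex, indexed as in
`coboundaries`. -/
abbrev GlobalCohomology (d : ∀ l, C l ⟶ C (l + 1)) (m : ℕ) : Type u :=
  ((d (m + 1)).hom.app (op ⊤)).hom.ker ⧸
    (coboundaries d m).addSubgroupOf ((d (m + 1)).hom.app (op ⊤)).hom.ker

theorem nonempty_H_equiv_of_iso {F G : AbSheaf X} (e : F ≅ G) (m : ℕ) :
    Nonempty (Sheaf.H F m ≃+ Sheaf.H G m) :=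
  ⟨((Sheaf.functorH _ m).mapIso e).addCommGroupIsoToAddEquiv⟩

theorem nonempty_globalCohomology_equiv_H [Mono (d 0)]
    (hex : ∀ l, (ShortComplex.mk (d l) (d (l + 1)) (w l)).Exact)
    (hac : ∀ l q, Subsingleton (Sheaf.H (C (l + 1)) (q + 1))) (m : ℕ) :
    Nonempty (GlobalCohomology d m ≃+ Sheaf.H (C 0) m) := by
  have : IsIso (kernel.lift (d 1) (d 0) (w 0)) := by
    have := (hex 0).epi_kernelLift
    have : Mono (kernel.lift (d 1) (d 0) (w 0)) := inferInstance
    exact isIso_of_mono_of_epi _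
  obtain ⟨augmentation⟩ := nonempty_H_equiv_of_iso (asIso (kernel.lift (d 1) (d 0) (w 0))) m
  cases m with
  | zero =>
    let sections := (Sheaf.H.equiv₀ (kernel (d 1)) isTerminalTop).trans (kernelSections (d 1) ⊤)
    exact ⟨(QuotientAddGroup.quotientAddEquivOfEq (by simp [coboundaries])).trans
      (QuotientAddGroup.quotientBot.trans (sections.symm.trans augmentation.symm))⟩
  | succ m =>
    have := hac m 0
    obtain ⟨base⟩ := nonempty_ker_quotient_range_equiv_H_one w (hex (m + 1))
    obtain ⟨shift⟩ := nonempty_H_cocycles_equiv (C := fun l => C (l + 1)) (d := fun l => d (l + 1))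
      (fun l => w (l + 1)) (fun l => hex (l + 1)) hac 0 m
    rw [Nat.zero_add] at shift
    exact ⟨base.trans (shift.trans augmentation.symm)⟩

end Resolution

end AbSheaf

/-- The sheaf cohomology `Hᵐ(X, M)` of a space with coefficients in the constant sheaf. -/
noncomputable abbrev ConstantCohomology (X : TopCat.{u}) (M : Type u) [AddCommGroup M] (m : ℕ) :
    Type u :=
  Sheaf.H.{u} ((constantSheaf (Opens.grothendieckTopology X) AddCommGrpCat.{u}).obj
    (AddCommGrpCat.of M)) m

/-! ### Čech cochains modulo 2 -/

theorem exists_rightInverse_of_nsmul_eq_zero {G H : Type*} [AddCommGroup G] [AddCommGroup H]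
    (p : ℕ) [Fact p.Prime] (hG : ∀ g : G, p • g = 0) {f : G →+ H} (hf : Function.Surjective f) :
    ∃ s : H →+ G, Function.RightInverse s f := by
  have hH : ∀ h : H, p • h = 0 := hf.forall.2 fun g => by rw [← map_nsmul, hG, map_zero]
  have : Module (ZMod p) G := AddCommGroup.zmodModule hG
  have : Module (ZMod p) H := AddCommGroup.zmodModule hH
  obtain ⟨s, hs⟩ := (f.toZModLinearMap p).exists_rightInverse_of_surjective
    (LinearMap.range_eq_top.2 hf)
  exact ⟨s.toAddMonoidHom, LinearMap.congr_fun hs⟩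

section ModTwo

variable {I M : Type*} [DecidableEq I] [AddCommGroup M] [Module (ZMod 2) M]

theorem sum_sum_erase_erase (φ : Finset I → M) (B : Finset I) :
    ∑ a ∈ B, ∑ b ∈ B.erase a, φ ((B.erase a).erase b) = 0 := by
  rw [Finset.sum_sigma']
  refine Finset.sum_involution (fun p _ => ⟨p.2, p.1⟩) ?_ ?_ ?_ fun _ _ => rfl
  · rintro ⟨a, b⟩ -
    rw [Finset.erase_right_comm, ZModModule.add_self]
  · rintro ⟨a, b⟩ h - heq
    exact Finset.ne_of_mem_erase (Finset.mem_sigma.1 h).2 (congrArg Sigma.fst heq)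
  · rintro ⟨a, b⟩ h
    simp only [Finset.mem_sigma, Finset.mem_erase] at h ⊢
    exact ⟨h.2.2, Ne.symm h.2.1, h.1⟩

theorem sum_cone (φ : Finset I → M) (i : I) (B : Finset I)
    (hφ : i ∉ B → ∑ c ∈ insert i B, φ ((insert i B).erase c) = 0) :
    ∑ b ∈ B, (if i ∈ B.erase b then 0 else φ (insert i (B.erase b))) = φ B := by
  by_cases hi : i ∈ B
  · rw [Finset.sum_eq_single_of_mem i hi fun b _ hb => if_pos (Finset.mem_erase.2 ⟨hb.symm, hi⟩),
      if_neg (Finset.notMem_erase i B), Finset.insert_erase hi]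
  · have hsum := hφ hi
    rw [Finset.sum_insert hi, Finset.erase_insert hi, ← ZModModule.sub_eq_add, sub_eq_zero] at hsum
    rw [hsum]
    refine Finset.sum_congr rfl fun b hb => ?_
    rw [if_neg fun h => hi (Finset.mem_of_mem_erase h),
      Finset.erase_insert_of_ne fun h : i = b => hi (h ▸ hb)]

end ModTwo

namespace Cech

variable {X : TopCat.{u}} {I : Type} (D : I → Opens X) (M : Type u) (l : ℕ)

variable {D} in
theorem mem_inf_of_subset {A B : Finset I} (h : A ⊆ B) {x : X} (hx : x ∈ B.inf D) : x ∈ A.inf D :=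
  SetLike.le_def.1 (Finset.inf_mono h) hx

/-- The disjoint union of the `l`-fold intersections of the family `D`. For `l = 0` this is `X`. -/
def total : TopCat.{u} :=
  TopCat.of (Σ A : {A : Finset I // A.card = l}, (A.1.inf D : Opens X))

/-- The projection of the disjoint union of the `l`-fold intersections to the base. -/
def proj : total D l ⟶ X :=
  TopCat.ofHom ⟨fun e => e.2.1, continuous_sigma fun _ => continuous_subtype_val⟩

/-- Sections over `U` of the sheaf of Čech cochains with values in `M` on `l`-fold intersections. -/
abbrev Cochain (U : Opens X) : Type u :=
  LocallyConstant ((Opens.map (proj D l)).obj U) M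

namespace Cochain

variable {D M l} {U : Opens X}

/-- The cochain with the values of a function that is locally constant where it matters. -/
def mk (φ : Finset I → X → M) (hφ : ∀ A : Finset I, A.card = l → ∀ x ∈ A.inf D, x ∈ U →
    ∀ᶠ y in 𝓝 x, φ A y = φ A x) : Cochain D M l U :=
  ⟨fun e => φ e.1.1.1 e.1.2.1, (IsLocallyConstant.iff_eventually_eq _).2 fun ⟨⟨A, x⟩, hU⟩ => by
    have hsigma : ∀ᶠ e in 𝓝 (⟨A, x⟩ : Σ A : {A : Finset I // A.card = l}, (A.1.inf D : Opens X)),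
        φ e.1.1 e.2.1 = φ A.1 x := by
      rw [Sigma.nhds_mk, eventually_map]
      exact (continuous_subtype_val.tendsto x).eventually (hφ A.1 A.2 x x.2 hU)
    exact Tendsto.eventually (p := fun e : total D l => φ e.1.1 e.2.1 = φ A.1 x)
      (continuous_subtype_val.tendsto _) hsigma⟩

variable [AddCommGroup M]

open Classical in
/-- The value of a cochain at `x ∈ ⋂ i ∈ A, D i`, with value `0` outside the domain. -/
noncomputable def val (f : Cochain D M l U) (A : Finset I) (x : X) : M :=
  if h : A.card = l ∧ x ∈ A.inf D ∧ x ∈ U then f ⟨⟨⟨A, h.1⟩, ⟨x, h.2.1⟩⟩, h.2.2⟩ else 0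

theorem val_of_mem (f : Cochain D M l U) {A : Finset I} {x : X} (hA : A.card = l)
    (hx : x ∈ A.inf D) (hU : x ∈ U) : f.val A x = f ⟨⟨⟨A, hA⟩, ⟨x, hx⟩⟩, hU⟩ :=
  dif_pos ⟨hA, hx, hU⟩

theorem ext_val {f g : Cochain D M l U}
    (h : ∀ A : Finset I, A.card = l → ∀ x ∈ A.inf D, x ∈ U → f.val A x = g.val A x) : f = g := by
  ext ⟨⟨⟨A, hA⟩, ⟨x, hx⟩⟩, hU⟩
  rw [← f.val_of_mem hA hx hU, ← g.val_of_mem hA hx hU, h A hA x hx hU]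

theorem val_zero (A : Finset I) (x : X) : (0 : Cochain D M l U).val A x = 0 := by
  unfold val
  split_ifs <;> rfl

theorem val_add (f g : Cochain D M l U) (A : Finset I) (x : X) :
    (f + g).val A x = f.val A x + g.val A x := by
  unfold val
  split_ifs
  · rfl
  · rw [add_zero]

theorem eventually_val_eq (f : Cochain D M l U) {A : Finset I} {x : X} (hA : A.card = l)
    (hx : x ∈ A.inf D) (hU : x ∈ U) : ∀ᶠ y in 𝓝 x, f.val A y = f.val A x := by
  let toTotal : (A.inf D ⊓ U : Opens X) → (Opens.map (proj D l)).obj U :=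
    fun y => ⟨⟨⟨A, hA⟩, ⟨y.1, y.2.1⟩⟩, y.2.2⟩
  have hcont : Continuous toTotal :=
    .subtype_mk (continuous_sigmaMk.comp (continuous_subtype_val.subtype_mk _)) _
  filter_upwards [eventually_locallyConstant_subtype_eq (f.comap ⟨toTotal, hcont⟩) ⟨x, hx, hU⟩,
    (A.inf D ⊓ U).isOpen.mem_nhds ⟨hx, hU⟩] with y hy hyU
  rw [f.val_of_mem hA hx hU, f.val_of_mem hA hyU.1 hyU.2]
  exact hy hyU

theorem val_mk {φ : Finset I → X → M} {hφ : ∀ A : Finset I, A.card = l → ∀ x ∈ A.inf D, x ∈ U →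
      ∀ᶠ y in 𝓝 x, φ A y = φ A x} {A : Finset I} {x : X} (hA : A.card = l) (hx : x ∈ A.inf D)
    (hU : x ∈ U) : (mk φ hφ).val A x = φ A x :=
  val_of_mem _ hA hx hU

variable [DecidableEq I]

/-- The Čech differential, without signs since it is only used modulo 2. -/
noncomputable def d : Cochain D M l U →+ Cochain D M (l + 1) U :=
  .mk' (fun f => mk (fun A x => ∑ a ∈ A, f.val (A.erase a) x) fun A hA x hx hU => by
    have hfaces : ∀ᶠ y in 𝓝 x, ∀ a ∈ A, f.val (A.erase a) y = f.val (A.erase a) x :=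
      (Finset.eventually_all A).2 fun a ha => f.eventually_val_eq
        (by rw [Finset.card_erase_of_mem ha, hA]; rfl) (mem_inf_of_subset (A.erase_subset a) hx) hU
    exact hfaces.mono fun y hy => Finset.sum_congr rfl hy) fun f g => ext_val fun A hA x hx hU => by
      simp only [val_mk hA hx hU, val_add, Finset.sum_add_distrib]

theorem val_d (f : Cochain D M l U) {A : Finset I} {x : X} (hA : A.card = l + 1)
    (hx : x ∈ A.inf D) (hU : x ∈ U) : (d f).val A x = ∑ a ∈ A, f.val (A.erase a) x :=
  val_of_mem _ hA hx hU

theorem d_d [Module (ZMod 2) M] (f : Cochain D M l U) : d (d f) = 0 := by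
  refine ext_val fun A hA x hx hU => ?_
  rw [val_d _ hA hx hU, val_zero, ← sum_sum_erase_erase (fun B => f.val B x) A]
  exact Finset.sum_congr rfl fun a ha => val_d _ (by rw [Finset.card_erase_of_mem ha, hA]; rfl)
    (mem_inf_of_subset (A.erase_subset a) hx) hU

end Cochain

/-- The function `v` chooses vertices over `U` along which cochains on `(l + 1)`-fold intersections
can be coned off: `v x` indexes a member of the family containing `x`, and where `v` is not locally
constant it stays among the indices of the intersection, where the cone vanishes. -/
structure IsConeVertex (U : Opens X) (v : X → I) : Prop where
  mem : ∀ A : Finset I, l ≤ A.card → ∀ x ∈ A.inf D, x ∈ U → x ∈ D (v x)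
  eventually : ∀ A : Finset I, l ≤ A.card → ∀ x ∈ A.inf D, x ∈ U →
    ∀ᶠ y in 𝓝 x, v y = v x ∨ v x ∈ A ∧ v y ∈ A

namespace IsConeVertex

variable {D M l} {U : Opens X}

theorem const (U : Opens X) (i : I) : IsConeVertex D l (U ⊓ D i) fun _ => i where
  mem _ _ _ _ hU := hU.2
  eventually _ _ _ _ _ := .of_forall fun _ => .inl rfl

variable [DecidableEq I] [AddCommGroup M] {v : X → I}

theorem mem_inf_insert (hv : IsConeVertex D l U v) {A : Finset I} (hA : l ≤ A.card) {x : X}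
    (hx : x ∈ A.inf D) (hU : x ∈ U) : x ∈ (insert (v x) A).inf D := by
  rw [Finset.inf_insert]
  exact ⟨hv.mem A hA x hx hU, hx⟩

/-- The cone of a cochain over a choice of vertices. -/
noncomputable def cone (hv : IsConeVertex D l U v) (f : Cochain D M (l + 1) U) :
    Cochain D M l U :=
  .mk (fun A x => if v x ∈ A then 0 else f.val (insert (v x) A) x) fun A hA x hx hU => by
    by_cases hvA : v x ∈ A
    · filter_upwards [hv.eventually A hA.ge x hx hU] with y hy
      rw [if_pos hvA, if_pos (hy.elim (fun h => h ▸ hvA) And.right)]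
    · filter_upwards [hv.eventually A hA.ge x hx hU, f.eventually_val_eq
        (by rw [Finset.card_insert_of_notMem hvA, hA]) (hv.mem_inf_insert hA.ge hx hU) hU]
        with y hy hfy
      rw [hy.resolve_right fun h => hvA h.1, if_neg hvA, if_neg hvA, hfy]

theorem val_cone (hv : IsConeVertex D l U v) (f : Cochain D M (l + 1) U) {A : Finset I} {x : X}
    (hA : A.card = l) (hx : x ∈ A.inf D) (hU : x ∈ U) :
    (hv.cone f).val A x = if v x ∈ A then 0 else f.val (insert (v x) A) x :=
  Cochain.val_mk hA hx hU

theorem d_cone [Module (ZMod 2) M] (hv : IsConeVertex D l U v) {f : Cochain D M (l + 1) U}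
    (hf : Cochain.d f = 0) : Cochain.d (hv.cone f) = f := by
  refine Cochain.ext_val fun B hB x hx hU => ?_
  rw [Cochain.val_d _ hB hx hU, ← sum_cone (fun B => f.val B x) (v x) B fun hvB => ?_]
  · exact Finset.sum_congr rfl fun b hb => hv.val_cone f
      (by rw [Finset.card_erase_of_mem hb, hB]; rfl) (mem_inf_of_subset (B.erase_subset b) hx) hU
  · rw [← Cochain.val_d f (by rw [Finset.card_insert_of_notMem hvB, hB])
      (hv.mem_inf_insert (hB ▸ l.le_succ) hx hU) hU, hf, Cochain.val_zero]

end IsConeVertex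

/-- An open cover of a space with a basis of clopen sets, such that every intersection of finitely
many, and at least one, of its members is ultraparacompact. The Čech complex of such a cover
computes sheaf cohomology. -/
structure IsLerayCover : Prop where
  isTopologicalBasis_isClopen : IsTopologicalBasis {s : Set X | IsClopen s}
  exists_mem : ∀ x, ∃ i, x ∈ D i
  ultraparacompact : ∀ A : Finset I, A.Nonempty → UltraparacompactSpace (A.inf D : Opens X)

section Resolution

variable [AddCommGroup M]

/-- The sheaf of Čech cochains with values in `M` on `l`-fold intersections. The index is the number
of sets that are intersected, so `cochains D M 0` is the sheaf of locally constant functions. -/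
noncomputable def cochains : AbSheaf X :=
  (AbSheaf.pushforward (proj D l)).obj (locConstSheaf (total D l) M)

theorem isHomeomorph_proj_zero : IsHomeomorph (proj D 0) := by
  refine isHomeomorph_iff_exists_inverse.2 ⟨(proj D 0).hom.continuous,
    fun x => ⟨⟨∅, rfl⟩, ⟨x, trivial⟩⟩, ?_, fun _ => rfl, ?_⟩
  · rintro ⟨⟨A, hA⟩, x⟩
    obtain rfl := Finset.card_eq_zero.1 hA
    rfl
  · exact continuous_sigmaMk.comp (continuous_id.subtype_mk _)

variable {D M l}

theorem Cochain.val_map {U V : Opens X} (f : Cochain D M l U) (h : V ≤ U) (A : Finset I) {x : X}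
    (hV : x ∈ V) :
    Cochain.val (U := V) ((cochains D M l).obj.map (homOfLE h).op f) A x = f.val A x := by
  unfold val
  by_cases hA : A.card = l ∧ x ∈ A.inf D
  · rw [dif_pos ⟨hA.1, hA.2, hV⟩, dif_pos ⟨hA.1, hA.2, h hV⟩]
    rfl
  · rw [dif_neg fun h => hA ⟨h.1, h.2.1⟩, dif_neg fun h => hA ⟨h.1, h.2.1⟩]

variable [DecidableEq I]

variable (D M) in
/-- The Čech differential modulo 2 as a morphism of sheaves. -/
noncomputable def diff (l : ℕ) : cochains D M l ⟶ cochains D M (l + 1) :=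
  ⟨{ app U := AddCommGrpCat.ofHom (Cochain.d (U := U.unop))
     naturality U V i := by
      ext f
      refine Cochain.ext_val (U := V.unop) fun A hA x hx hV => ?_
      calc Cochain.val (Cochain.d (U := V.unop) ((cochains D M l).obj.map i f)) A x
        _ = ∑ a ∈ A, Cochain.val (U := U.unop) f (A.erase a) x :=
          (Cochain.val_d (U := V.unop) _ hA hx hV).trans
            (Finset.sum_congr rfl fun a _ => Cochain.val_map f i.unop.le (A.erase a) hV)
        _ = Cochain.val (U := V.unop) ((cochains D M (l + 1)).obj.map i (Cochain.d f)) A x :=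
          ((Cochain.val_map (Cochain.d f) i.unop.le A hV).trans
            (Cochain.val_d f hA hx (i.unop.le hV))).symm }⟩

theorem mono_diff_zero (hcov : ∀ x, ∃ i, x ∈ D i) : Mono (diff D M 0) := by
  have injective_app (U : (Opens X)ᵒᵖ) : Mono ((diff D M 0).hom.app U) := by
    refine (AddCommGrpCat.mono_iff_injective _).2 fun f g hfg => ?_
    refine Cochain.ext_val (U := U.unop) fun A hA x _ hU => ?_
    obtain rfl := Finset.card_eq_zero.1 hA
    obtain ⟨i, hi⟩ := hcov x
    have val_d_singleton (f : Cochain D M 0 U.unop) :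
        (Cochain.d f).val {i} x = f.val ∅ x := by
      rw [f.val_d (Finset.card_singleton i) (by rwa [Finset.inf_singleton]) hU,
        Finset.sum_singleton, Finset.erase_singleton]
    exact (val_d_singleton f).symm.trans
      ((congrArg (fun c : Cochain D M 1 U.unop => c.val {i} x) hfg).trans (val_d_singleton g))
  have : Mono (diff D M 0).hom := NatTrans.mono_of_mono_app _
  exact (sheafToPresheaf _ _).mono_of_mono_map this

variable [Module (ZMod 2) M]

variable (D M) in
theorem diff_diff (l : ℕ) : diff D M l ≫ diff D M (l + 1) = 0 := by
  ext U f
  exact Cochain.d_d (U := U.unop) f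

theorem exact_diff (hcov : ∀ x, ∃ i, x ∈ D i) (l : ℕ) :
    (ShortComplex.mk (diff D M l) (diff D M (l + 1)) (diff_diff D M l)).Exact := by
  refine AbSheaf.exact_of_locally_exact fun U s hs x hx => ?_
  obtain ⟨i, hi⟩ := hcov x
  have hcocycle : Cochain.d (U := U ⊓ D i)
      ((cochains D M (l + 1)).obj.map (homOfLE inf_le_left).op s) = 0 :=
    ((diff D M (l + 1)).hom.naturality_apply (homOfLE inf_le_left).op s).trans
      ((congrArg _ hs).trans (map_zero _))
  exact ⟨U ⊓ D i, inf_le_left, ⟨hx, hi⟩, _, (IsConeVertex.const U i).d_cone hcocycle⟩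

theorem IsLerayCover.nonempty_globalCohomology_equiv_H (hD : IsLerayCover D) (m : ℕ) :
    Nonempty (AbSheaf.GlobalCohomology (diff D M) m ≃+ ConstantCohomology X M m) := by
  have hac (l q : ℕ) : Subsingleton (Sheaf.H (cochains D M (l + 1)) (q + 1)) :=
    AbSheaf.subsingleton_H_pushforward (proj D (l + 1)) hD.isTopologicalBasis_isClopen
      (UltraparacompactSpace.sigma fun A =>
        hD.ultraparacompact A.1 (Finset.card_pos.1 (by lia))) _ q
  have := mono_diff_zero (M := M) hD.exists_mem
  obtain ⟨toH⟩ :=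
    AbSheaf.nonempty_globalCohomology_equiv_H (diff_diff D M) (exact_diff hD.exists_mem) hac m
  obtain ⟨augmentation⟩ :=
    AbSheaf.nonempty_locConstSheaf_iso_pushforward (isHomeomorph_proj_zero D) M
  obtain ⟨constant⟩ := nonempty_constantSheaf_iso_locConstSheaf X M
  obtain ⟨transport⟩ := AbSheaf.nonempty_H_equiv_of_iso (constant ≪≫ augmentation) m
  exact ⟨toH.trans transport.symm⟩

end Resolution

section Restriction

variable {D M l} {Z : TopCat.{u}} {ι : Z ⟶ X}

variable (D ι) in
/-- The preimage of a family of open sets. -/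
abbrev preimage : I → Opens Z := fun i => Opens.comap ι.hom (D i)

theorem inf_preimage (A : Finset I) : A.inf (preimage D ι) = Opens.comap ι.hom (A.inf D) :=
  (map_finset_inf (Opens.comap ι.hom) A D).symm

theorem mem_inf_preimage {A : Finset I} {z : Z} : z ∈ A.inf (preimage D ι) ↔ ι z ∈ A.inf D := by
  rw [inf_preimage]
  rfl

variable (D ι) in
/-- The map induced by `ι` on intersections of members of the family. -/
def infMap (A : Finset I) (z : (A.inf (preimage D ι) : Opens Z)) : (A.inf D : Opens X) :=
  ⟨ι z.1, mem_inf_preimage.1 z.2⟩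

theorem isClosedEmbedding_infMap (hι : IsClosedEmbedding ι) (A : Finset I) :
    IsClosedEmbedding (infMap D ι A) :=
  (hι.restrictPreimage ((A.inf D : Opens X) : Set X)).comp
    (Homeomorph.setCongr (congrArg SetLike.coe (inf_preimage A))).isClosedEmbedding

theorem IsLerayCover.preimage (hD : IsLerayCover D) (hι : IsClosedEmbedding ι) :
    IsLerayCover (preimage D ι) where
  isTopologicalBasis_isClopen :=
    isTopologicalBasis_isClopen_of_isInducing hD.isTopologicalBasis_isClopen hι.isInducing
  exists_mem z := hD.exists_mem (ι z)
  ultraparacompact A hA := (hD.ultraparacompact A hA).of_isClosedEmbedding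
    (isClosedEmbedding_infMap hι A)

variable [AddCommGroup M]

namespace Cochain

/-- Restriction of global cochains along a continuous map. -/
noncomputable def restrict (ι : Z ⟶ X) : Cochain D M l ⊤ →+ Cochain (preimage D ι) M l ⊤ :=
  .mk' (fun f => mk (fun A z => f.val A (ι z)) fun _ hA z hz _ =>
    (ι.hom.continuous.tendsto z).eventually
      (f.eventually_val_eq hA (mem_inf_preimage.1 hz) trivial))
    fun f g => ext_val fun A hA z hz hU => by simp only [val_mk hA hz hU, val_add]

theorem val_restrict (f : Cochain D M l ⊤) {A : Finset I} {z : Z} (hA : A.card = l)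
    (hz : z ∈ A.inf (preimage D ι)) : (restrict ι f).val A z = f.val A (ι z) :=
  val_of_mem (U := ⊤) _ hA hz trivial

theorem d_restrict [DecidableEq I] (f : Cochain D M l ⊤) :
    d (restrict ι f) = restrict ι (d f) := by
  refine ext_val fun A hA z hz hU => ?_
  rw [val_d _ hA hz hU, val_restrict _ hA hz, val_d _ hA (mem_inf_preimage.1 hz) (Opens.mem_top _)]
  exact Finset.sum_congr rfl fun a ha => val_restrict f
    (by rw [Finset.card_erase_of_mem ha, hA]; rfl) (mem_inf_of_subset (A.erase_subset a) hz)

theorem exists_val_eq (F : ∀ A : Finset I, A.card = l → LocallyConstant (A.inf D : Opens X) M) :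
    ∃ f : Cochain D M l ⊤, ∀ (A : Finset I) (hA : A.card = l) (x : (A.inf D : Opens X)),
      f.val A x = F A hA x := by
  classical
  refine ⟨mk (fun A x => if h : A.card = l ∧ x ∈ A.inf D then F A h.1 ⟨x, h.2⟩ else 0)
    fun A hA x hx _ => ?_, fun A hA x =>
      (val_mk hA x.2 (Opens.mem_top _)).trans (dif_pos ⟨hA, x.2⟩)⟩
  filter_upwards [eventually_locallyConstant_subtype_eq (F A hA) ⟨x, hx⟩,
    (A.inf D).isOpen.mem_nhds hx] with y hy hyA
  rw [dif_pos ⟨hA, hyA⟩, dif_pos ⟨hA, hx⟩, hy hyA]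

theorem surjective_restrict (hD : IsLerayCover D) (hι : IsClosedEmbedding ι) :
    Function.Surjective (restrict ι : Cochain D M (l + 1) ⊤ →+ _) := by
  intro g
  have hext (A : Finset I) (hA : A.card = l + 1) : ∃ F : LocallyConstant (A.inf D : Opens X) M,
      ∀ z, F (infMap D ι A z) = g.val A z :=
    (hD.ultraparacompact A (Finset.card_pos.1 (by lia))).exists_extension
      (isClosedEmbedding_infMap hι A) ⟨fun z => g.val A z,
        (IsLocallyConstant.iff_eventually_eq _).2 fun z =>
          (continuous_subtype_val.tendsto z).eventually (g.eventually_val_eq hA z.2 trivial)⟩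
  choose F hF using hext
  obtain ⟨f, hf⟩ := exists_val_eq F
  refine ⟨f, ext_val fun A hA z hz _ => ?_⟩
  rw [val_restrict f hA hz, ← hF A hA ⟨z, hz⟩]
  exact hf A hA (infMap D ι A ⟨z, hz⟩)

end Cochain

variable [DecidableEq I]

theorem IsConeVertex.restrict_cone_eq_zero {v : X → I} (hv : IsConeVertex D l ⊤ v)
    {f : Cochain D M (l + 1) ⊤} (hf : Cochain.restrict ι f = 0) :
    Cochain.restrict ι (hv.cone f) = 0 := by
  refine Cochain.ext_val fun A hA z hz _ => ?_
  have hx := mem_inf_preimage.1 hz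
  rw [Cochain.val_restrict _ hA hz, hv.val_cone f hA hx trivial, Cochain.val_zero]
  split_ifs with hvA
  · rfl
  · rw [← Cochain.val_restrict f (by rw [Finset.card_insert_of_notMem hvA, hA])
      (mem_inf_preimage.2 (hv.mem_inf_insert hA.ge hx trivial)), hf, Cochain.val_zero]

theorem restrict_mem_coboundaries {m : ℕ} {f : Cochain D M (m + 1) ⊤}
    (hf : f ∈ AbSheaf.coboundaries (diff D M) m) :
    Cochain.restrict ι f ∈ AbSheaf.coboundaries (diff (preimage D ι) M) m := by
  cases m with
  | zero =>
    obtain rfl : f = 0 := hf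
    exact map_zero _
  | succ m =>
    obtain ⟨e, rfl⟩ := hf
    exact ⟨Cochain.restrict ι e, Cochain.d_restrict e⟩

variable (D M ι) in
/-- The map induced by restriction on the cohomology of the global Čech complexes. -/
noncomputable def restrictCohomology (m : ℕ) : AbSheaf.GlobalCohomology (diff D M) m →+
    AbSheaf.GlobalCohomology (diff (preimage D ι) M) m :=
  QuotientAddGroup.map _ _
    (((Cochain.restrict ι).comp (AddSubgroup.subtype _)).codRestrict _
      fun f : ((diff D M (m + 1)).hom.app (op ⊤)).hom.ker =>
        (Cochain.d_restrict f.1).trans ((congrArg _ f.2).trans (map_zero (Cochain.restrict ι))))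
    fun _ hf => restrict_mem_coboundaries hf

variable [Module (ZMod 2) M]

theorem IsConeVertex.exists_cocycle_restrict_eq {v : X → I} (hv : IsConeVertex D (l + 1) ⊤ v)
    (hD : IsLerayCover D) (hι : IsClosedEmbedding ι) {g : Cochain (preimage D ι) M (l + 1) ⊤}
    (hg : Cochain.d g = 0) :
    ∃ f : Cochain D M (l + 1) ⊤, Cochain.d f = 0 ∧ Cochain.restrict ι f = g := by
  obtain ⟨e, rfl⟩ := Cochain.surjective_restrict hD hι g
  have hde : Cochain.restrict ι (Cochain.d e) = 0 := by rw [← Cochain.d_restrict, hg]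
  refine ⟨e - hv.cone (Cochain.d e), ?_, ?_⟩
  · rw [map_sub, hv.d_cone (Cochain.d_d e), sub_self]
  · rw [map_sub, hv.restrict_cone_eq_zero hde, sub_zero]

theorem IsConeVertex.surjective_restrictCohomology {m : ℕ} {v : X → I}
    (hv : IsConeVertex D (m + 1) ⊤ v) (hD : IsLerayCover D) (hι : IsClosedEmbedding ι) :
    Function.Surjective (restrictCohomology D M ι m) := by
  refine QuotientAddGroup.map_surjective_of_surjective _ _ _ ?_ _
  rintro ⟨⟨g, hg⟩⟩
  obtain ⟨f, hf, rfl⟩ := hv.exists_cocycle_restrict_eq hD hι hg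
  exact ⟨⟨f, hf⟩, rfl⟩

end Restriction

section Cohomology

variable {D} [AddCommGroup M] [Module (ZMod 2) M] {m : ℕ} {v : X → I}

theorem two_nsmul_globalCohomology [DecidableEq I]
    (c : AbSheaf.GlobalCohomology (diff D M) m) : 2 • c = 0 := by
  obtain ⟨⟨f, hf⟩, rfl⟩ := QuotientAddGroup.mk_surjective c
  rw [← QuotientAddGroup.mk_nsmul]
  exact congrArg _ (Subtype.ext (ZModModule.char_nsmul_eq_zero 2 (G := Cochain D M (m + 1) ⊤) f))

theorem IsLerayCover.subsingleton_H (hD : IsLerayCover D) (hv : IsConeVertex D (m + 1) ⊤ v) :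
    Subsingleton (ConstantCohomology X M (m + 1)) := by
  classical
  obtain ⟨e⟩ := hD.nonempty_globalCohomology_equiv_H (M := M) (m + 1)
  refine e.symm.subsingleton_congr.2 (subsingleton_of_forall_eq 0 fun c => ?_)
  obtain ⟨⟨f, hf⟩, rfl⟩ := QuotientAddGroup.mk_surjective c
  exact (QuotientAddGroup.eq_zero_iff _).2 ⟨hv.cone f, hv.d_cone hf⟩

theorem IsLerayCover.exists_injective_H (hD : IsLerayCover D) (hv : IsConeVertex D (m + 1) ⊤ v)
    {Z : TopCat.{u}} {ι : Z ⟶ X} (hι : IsClosedEmbedding ι) :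
    ∃ φ : ConstantCohomology Z M m →+ ConstantCohomology X M m, Function.Injective φ := by
  classical
  obtain ⟨toHX⟩ := hD.nonempty_globalCohomology_equiv_H (M := M) m
  obtain ⟨toHZ⟩ := (hD.preimage hι).nonempty_globalCohomology_equiv_H (M := M) m
  obtain ⟨s, hs⟩ := exists_rightInverse_of_nsmul_eq_zero 2 (two_nsmul_globalCohomology M)
    (hv.surjective_restrictCohomology (M := M) hD hι)
  exact ⟨toHX.toAddMonoidHom.comp (s.comp toHZ.symm.toAddMonoidHom),
    toHX.injective.comp (hs.injective.comp toHZ.symm.injective)⟩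

end Cohomology

end Cech

/-! ### Punctured cuboids -/

namespace Cuboid

variable {n : ℕ} {κ : Fin (n + 1) → Cardinal.{u}}

/-- The underlying point of the product. -/
def pt (x : Punctured κ) : Space κ := x.1

theorem isEmbedding_pt : IsEmbedding (pt (κ := κ)) := .subtypeVal

theorem continuous_pt_apply (i : Fin (n + 1)) : Continuous fun x : Punctured κ => pt x i :=
  (continuous_apply i).comp isEmbedding_pt.continuous

variable (κ) in
/-- The open set of points whose coordinate with index `i` is finite. -/
def finCoord (i : Fin (n + 1)) : Opens (Punctured κ) :=
  ⟨{x | pt x i ≠ OnePoint.infty}, isOpen_compl_singleton.preimage (continuous_pt_apply i)⟩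

theorem mem_inf_finCoord {A : Finset (Fin (n + 1))} {x : Punctured κ} :
    x ∈ A.inf (finCoord κ) ↔ pt x ∈ D κ A := by
  rw [← SetLike.mem_coe, Opens.coe_finset_inf, Finset.inf_eq_iInf, Set.iInf_eq_iInter]
  simp only [Set.iInf_eq_iInter, Set.mem_iInter]
  rfl

theorem eventually_pt_apply_eq {x : Punctured κ} {i : Fin (n + 1)} (hi : x ∈ finCoord κ i) :
    ∀ᶠ y in 𝓝 x, pt y i = pt x i := by
  obtain ⟨a, ha⟩ := OnePoint.ne_infty_iff_exists.1 hi
  have hopen : IsOpen ({pt x i} : Set (OnePoint (Disc (κ i)))) := by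
    rw [← ha, ← Set.image_singleton, OnePoint.isOpen_image_coe]
    exact isOpen_discrete _
  exact (continuous_pt_apply i).continuousAt.eventually (hopen.mem_nhds rfl)

section LerayCover

variable (A : Finset (Fin (n + 1)))

/-- The finite coordinates with index in `A`, as a locally constant function on `D_A`. -/
def coordsOn : LocallyConstant (A.inf (finCoord κ) : Opens (Punctured κ))
    (∀ i : A, OnePoint (Disc (κ i))) :=
  ⟨fun y i => pt y.1 i, (IsLocallyConstant.iff_eventually_eq _).2 fun x =>
    ((eventually_all.2 fun i : A => (continuous_subtype_val.tendsto x).eventually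
      (eventually_pt_apply_eq (mem_inf_finCoord.1 x.2 i.1 i.2))).mono fun _ => funext)⟩

variable {A}

theorem isClosedEmbedding_fiber_coordsOn (hA : A.Nonempty) (a : ∀ i : A, OnePoint (Disc (κ i))) :
    IsClosedEmbedding fun y : coordsOn A ⁻¹' {a} => pt y.1.1 := by
  refine ⟨isEmbedding_pt.comp (IsEmbedding.subtypeVal.comp .subtypeVal), ?_⟩
  have hrange : Set.range (fun y : coordsOn A ⁻¹' {a} => pt y.1.1) =
      ⋂ i : A, {x : Space κ | x i = a i} ∩ {_x | a i ≠ OnePoint.infty} := by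
    ext x
    simp only [Set.mem_iInter]
    constructor
    · rintro ⟨⟨y, rfl⟩, rfl⟩ i
      exact ⟨rfl, mem_inf_finCoord.1 y.2 i i.2⟩
    · intro hx
      have hxD : x ∈ D κ A := fun i hi => (hx ⟨i, hi⟩).1.trans_ne (hx ⟨i, hi⟩).2
      obtain ⟨i, hi⟩ := hA
      let y : Punctured κ := ⟨x, fun h => hxD i hi (congrFun h i)⟩
      exact ⟨⟨⟨y, mem_inf_finCoord.2 hxD⟩, funext fun i => (hx i).1⟩, rfl⟩
  rw [hrange]
  exact isClosed_iInter fun i =>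
    (isClosed_eq (continuous_apply i.1) continuous_const).inter isClosed_const

variable (κ) in
theorem isLerayCover_finCoord : Cech.IsLerayCover (finCoord κ) where
  isTopologicalBasis_isClopen :=
    isTopologicalBasis_isClopen_of_isInducing isTopologicalBasis_isClopen
      (isEmbedding_pt (κ := κ)).isInducing
  exists_mem x := by
    by_contra! h
    exact x.2 (funext fun i => not_not.1 (h i))
  ultraparacompact A hA := .of_fibers (coordsOn A) fun a =>
    UltraparacompactSpace.of_profinite.of_isClosedEmbedding (isClosedEmbedding_fiber_coordsOn hA a)

end LerayCover

namespace IsFubini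

variable {k : ℤ} {Y : Fin (n + 1) → Set (Space κ)}

theorem nonneg (hY : IsFubini κ k Y) : 0 ≤ k := by
  by_contra! hk
  obtain ⟨E, hE⟩ := hY.nbhd ∅ (by simpa using hk) (inftyPt κ) fun i => by simp [inftyPt]
  have hmem : inftyPt κ ∈ Nbhd κ ∅ (inftyPt κ) E := ⟨by simp, fun _ _ => .inl rfl⟩
  simpa using hE hmem

theorem exists_mem (hY : IsFubini κ k Y) (x : Punctured κ) : ∃ i, pt x ∈ Y i :=
  Set.mem_iUnion.1 (hY.cover ▸ x.2)

/-- The index of the piece of the partition that contains a point. -/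
noncomputable def idx (hY : IsFubini κ k Y) (x : Punctured κ) : Fin (n + 1) :=
  (hY.exists_mem x).choose

theorem idx_eq_iff (hY : IsFubini κ k Y) {x : Punctured κ} {i : Fin (n + 1)} :
    hY.idx x = i ↔ pt x ∈ Y i := by
  have hx : pt x ∈ Y (hY.idx x) := (hY.exists_mem x).choose_spec
  exact ⟨fun h => h ▸ hx, fun h => hY.disjoint.eq (Set.not_disjoint_iff.2 ⟨_, hx, h⟩)⟩

variable {A : Finset (Fin (n + 1))} {x : Punctured κ}

theorem mem_finCoord_idx (hY : IsFubini κ k Y) (hA : k + 1 ≤ (A.card : ℤ)) (hx : pt x ∈ D κ A) :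
    x ∈ finCoord κ (hY.idx x) := by
  classical
  let B : Finset (Fin (n + 1)) := Finset.univ.filter fun i => pt x i ≠ OnePoint.infty
  have hB (i) : pt x i ≠ OnePoint.infty ↔ i ∈ B := by simp [B]
  have hAB : A ⊆ B := fun i hi => (hB i).1 (hx i hi)
  obtain ⟨E, hE⟩ := hY.nbhd B (hA.trans (mod_cast Finset.card_le_card hAB)) (pt x) hB
  have hmem : pt x ∈ Nbhd κ B (pt x) E :=
    ⟨fun _ _ => rfl, fun j hj => .inl (not_not.1 fun h => hj ((hB j).1 h))⟩
  obtain ⟨i, hi, hxi⟩ := Set.mem_iUnion₂.1 (hE hmem)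
  rw [hY.idx_eq_iff.2 hxi]
  exact (hB i).2 hi

theorem eventually_idx_eq_iff (hY : IsFubini κ k Y) (hA : k + 1 ≤ (A.card : ℤ))
    (hx : pt x ∈ D κ A) {i : Fin (n + 1)} (hi : i ∉ A) :
    ∀ᶠ y in 𝓝 x, (hY.idx y = i ↔ hY.idx x = i) := by
  have hD : ∀ᶠ y : D κ A in 𝓝 ⟨pt x, hx⟩, ((y : Space κ) ∈ Y i ↔ pt x ∈ Y i) := by
    by_cases h : pt x ∈ Y i
    · exact ((hY.clopen A hA i hi).isOpen.eventually_mem h).mono fun _ hy => iff_of_true hy h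
    · exact ((hY.clopen A hA i hi).compl.isOpen.eventually_mem h).mono
        fun _ hy => iff_of_false hy h
  rw [nhds_subtype_eq_comap, eventually_comap] at hD
  filter_upwards [isEmbedding_pt.continuous.continuousAt.eventually hD,
    (A.inf (finCoord κ)).isOpen.mem_nhds (mem_inf_finCoord.2 hx)] with y hy hyA
  rw [hY.idx_eq_iff, hY.idx_eq_iff]
  exact hy ⟨pt y, mem_inf_finCoord.1 hyA⟩ rfl

theorem isConeVertex_idx (hY : IsFubini κ k Y) {l : ℕ} (hl : k + 1 ≤ l) :
    Cech.IsConeVertex (finCoord κ) l ⊤ hY.idx where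
  mem A hA x hx _ := hY.mem_finCoord_idx (hl.trans (mod_cast hA)) (mem_inf_finCoord.1 hx)
  eventually A hA x hx _ := by
    have hiff : ∀ᶠ y in 𝓝 x, ∀ i ∉ A, (hY.idx y = i ↔ hY.idx x = i) :=
      eventually_all.2 fun i => eventually_imp_distrib_left.2 fun hi =>
        hY.eventually_idx_eq_iff (hl.trans (mod_cast hA)) (mem_inf_finCoord.1 hx) hi
    filter_upwards [hiff] with y hy
    by_cases hxA : hY.idx x ∈ A
    · refine .inr ⟨hxA, by_contra fun hyA => hyA ?_⟩
      rwa [← (hy _ hyA).1 rfl]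
    · exact .inl ((hy _ hxA).2 rfl)

end IsFubini

theorem continuous_onePointMap {S T : Type*} [TopologicalSpace S] [DiscreteTopology S]
    [TopologicalSpace T] [DiscreteTopology T] {f : S → T} (hf : Function.Injective f) :
    Continuous (OnePoint.map f) := by
  refine OnePoint.continuous_map continuous_of_discreteTopology ?_
  simp only [coclosedCompact_eq_cocompact, cocompact_eq_cofinite]
  exact hf.tendsto_cofinite

theorem exists_isClosedEmbedding_punctured {μ : Fin (n + 1) → Cardinal.{u}}
    (hμ : ∀ i, μ i ≤ κ i) :
    ∃ ι : Punctured μ ⟶ Punctured κ, IsClosedEmbedding ι := by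
  let e (i) : Disc (μ i) ↪ Disc (κ i) := (Cardinal.out_embedding.1 (hμ i)).some
  let f : Space μ → Space κ := Pi.map fun i => OnePoint.map (e i)
  have hinj : Function.Injective f := .piMap fun i => Option.map_injective (e i).injective
  have hcont : Continuous f := .piMap fun i => continuous_onePointMap (e i).injective
  have hpreimage : {x | x ≠ inftyPt μ} = f ⁻¹' {x | x ≠ inftyPt κ} :=
    Set.ext fun x => (hinj.ne_iff' rfl).symm
  have hι := ((hcont.isClosedEmbedding hinj).restrictPreimage {x | x ≠ inftyPt κ}).comp
    (Homeomorph.setCongr hpreimage).isClosedEmbedding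
  exact ⟨TopCat.ofHom ⟨_, hι.continuous⟩, hι⟩

end Cuboid

theorem theorem2_general {n : ℕ} {κ : Fin (n + 1) → Cardinal.{u}} {k : ℤ}
    {Y : Fin (n + 1) → Set (Cuboid.Space κ)} (hY : Cuboid.IsFubini κ k Y) (M : Type u)
    [AddCommGroup M] [Module (ZMod 2) M] :
    (∀ m : ℕ, k + 1 ≤ (m : ℤ) → Subsingleton (ConstantCohomology (Cuboid.Punctured κ) M m)) ∧
    (∀ m : ℕ, k ≤ (m : ℤ) → ∀ μ : Fin (n + 1) → Cardinal.{u}, (∀ i, μ i ≤ κ i) →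
      ∃ φ : ConstantCohomology (Cuboid.Punctured μ) M m →+
        ConstantCohomology (Cuboid.Punctured κ) M m, Function.Injective φ) := by
  have hcover := Cuboid.isLerayCover_finCoord κ
  constructor
  · intro m hm
    obtain ⟨m, rfl⟩ := Nat.exists_eq_add_of_lt (show 0 < m by have := hY.nonneg; lia)
    rw [zero_add]
    exact hcover.subsingleton_H M (hY.isConeVertex_idx (by lia))
  · intro m hm μ hμ
    obtain ⟨ι, hι⟩ := Cuboid.exists_isClosedEmbedding_punctured hμ
    exact hcover.exists_injective_H M (hY.isConeVertex_idx (by lia)) hι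

theorem theorem2 {n : ℕ} (κ : Fin (n + 1) → Cardinal.{u}) (k : ℤ) (hk : -1 ≤ k) (hkn : k ≤ n)
    (hκ : ∃ Y : Fin (n + 1) → Set (Cuboid.Space κ), Cuboid.IsFubini κ k Y) :
    (∀ m : ℕ, k + 1 ≤ (m : ℤ) → Subsingleton (Cuboid.H m κ)) ∧
    (∀ m : ℕ, (m : ℤ) = k → ∀ μ : Fin (n + 1) → Cardinal.{u}, (∀ i, μ i ≤ κ i) →
      ∃ φ : Cuboid.H m μ →+ Cuboid.H m κ, Function.Injective φ) := by
  obtain ⟨_, hY⟩ := hκ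
  exact ⟨(theorem2_general hY _).1, fun m hm => (theorem2_general hY _).2 m hm.ge⟩
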